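/- Let $R$ be a Cohen–Macaulay (Noetherian) local ring that is Gorenstein, i.e. $R$ has finite injective dimension as a module over itself. Let $I$ be a strongly Cohen–Macaulay ideal of $R$, i.e. for some finite generating sequence $x_1,\dots,x_n$ of $I$ (equivalently, for every one) all homology modules $H_i(x_1,\dots,x_n;R)$, $i\ge 0$, of the Koszul complex are Cohen–Macaulay $R$-modules. Then $R/\operatorname{Ann}_R(I)$ is a maximal Cohen–Macaulay $R$-module. Here a finitely generated $R$-module $M$ is Cohen–Macaulay if $M=0$ or $\operatorname{depth} M=\dim M$, and maximal Cohen–Macaulay if $M=0$ or $\operatorname{depth} M=\dim M=\dim R$. (The module $R/\operatorname{Ann}_R(I)$ is zero only when $I=0$.) -/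

import Mathlib

universe u v

section DepthAndCohenMacaulay

variable (R : Type u) [CommRing R] [IsLocalRing R] (M : Type v) [AddCommGroup M] [Module R M]

/-- The depth of a module over a local ring: the supremum of the lengths of the `M`-regular
sequences consisting of elements of the maximal ideal. -/
noncomputable def moduleDepth : ℕ∞ :=
  ⨆ (rs : List R) (_ : RingTheory.Sequence.IsRegular M rs ∧
    ∀ r ∈ rs, r ∈ IsLocalRing.maximalIdeal R), (rs.length : ℕ∞)

/-- A Cohen-Macaulay module over a (Noetherian) local ring: a finitely generated module that is
either zero or satisfies `depth M = dim M`. -/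
structure IsCohenMacaulayModule : Prop where
  finite : Module.Finite R M
  depth_eq_dim : Nontrivial M → (moduleDepth R M : WithBot ℕ∞) = Module.supportDim R M

/-- A maximal Cohen-Macaulay module over a (Noetherian) local ring: a Cohen-Macaulay module that
is either zero or satisfies `dim M = dim R`. -/
structure IsMaximalCohenMacaulayModule : Prop extends IsCohenMacaulayModule R M where
  dim_eq_dim : Nontrivial M → Module.supportDim R M = ringKrullDim R

end DepthAndCohenMacaulay

/-- The Gorenstein condition on a Noetherian local ring: `R` has finite injective dimension as a
module over itself. -/
def IsGorensteinRing (R : Type u) [CommRing R] : Prop :=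
  CategoryTheory.injectiveDimension (ModuleCat.of R R) ≠ ⊤

section Koszul

variable {R : Type u} [CommRing R] {n : ℕ} (x : Fin n → R)

/-- The Koszul differential of the sequence `x` on the exterior algebra of `R ^ n`: contraction
with the linear form `R ^ n → R`, `e_j ↦ x j`, i.e. the antiderivation of degree `-1` that
extends this linear form. -/
noncomputable def koszulDifferential :
    ExteriorAlgebra R (Fin n → R) →ₗ[R] ExteriorAlgebra R (Fin n → R) :=
  CliffordAlgebra.contractLeft (Fintype.linearCombination R x)

theorem koszulDifferential_ι_mul (v : Fin n → R) (b : ExteriorAlgebra R (Fin n → R)) :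
    koszulDifferential x (ExteriorAlgebra.ι R v * b) =
      (∑ j, v j * x j) • b - ExteriorAlgebra.ι R v * koszulDifferential x b := by
  simp only [koszulDifferential, ExteriorAlgebra.ι, CliffordAlgebra.contractLeft_ι_mul,
    Fintype.linearCombination_apply, smul_eq_mul]

theorem koszulDifferential_koszulDifferential (b : ExteriorAlgebra R (Fin n → R)) :
    koszulDifferential x (koszulDifferential x b) = 0 :=
  CliffordAlgebra.contractLeft_contractLeft _ b

theorem koszulDifferential_mem (i : ℕ) {b : ExteriorAlgebra R (Fin n → R)}
    (hb : b ∈ ⋀[R]^(i + 1) (Fin n → R)) : koszulDifferential x b ∈ ⋀[R]^i (Fin n → R) := by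
  induction i generalizing b with
  | zero =>
    rw [ExteriorAlgebra.exteriorPower, zero_add, pow_one] at hb
    obtain ⟨v, rfl⟩ := hb
    have h := koszulDifferential_ι_mul x v 1
    rw [mul_one] at h
    rw [h, ExteriorAlgebra.exteriorPower, pow_zero]
    simp only [koszulDifferential, CliffordAlgebra.contractLeft_one, mul_zero, sub_zero]
    exact Submodule.smul_mem _ _ (Submodule.one_le.mp le_rfl)
  | succ i ih =>
    rw [ExteriorAlgebra.exteriorPower, pow_succ'] at hb
    induction hb using Submodule.mul_induction_on' with
    | mem_mul_mem m hm c hc =>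
      obtain ⟨v, rfl⟩ := hm
      rw [koszulDifferential_ι_mul]
      refine Submodule.sub_mem _ (Submodule.smul_mem _ _ hc) ?_
      rw [ExteriorAlgebra.exteriorPower, pow_succ']
      exact Submodule.mul_mem_mul ⟨v, rfl⟩ (ih hc)
    | add a _ b _ ha hb =>
      rw [map_add]
      exact Submodule.add_mem _ ha hb

/-- The Koszul cycles of degree `i`, inside the `i`-th exterior power of `R ^ n`. -/
noncomputable def koszulCycles (i : ℕ) : Submodule R (ExteriorAlgebra R (Fin n → R)) :=
  LinearMap.ker (koszulDifferential x) ⊓ ⋀[R]^i (Fin n → R)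

/-- The Koszul boundaries of degree `i`: the image of the `(i + 1)`-st exterior power. -/
noncomputable def koszulBoundaries (i : ℕ) : Submodule R (ExteriorAlgebra R (Fin n → R)) :=
  (⋀[R]^(i + 1) (Fin n → R)).map (koszulDifferential x)

theorem koszulBoundaries_le_koszulCycles (i : ℕ) : koszulBoundaries x i ≤ koszulCycles x i := by
  rintro _ ⟨b, hb, rfl⟩
  exact ⟨koszulDifferential_koszulDifferential x b, koszulDifferential_mem x i hb⟩

/-- The `i`-th homology module of the Koszul complex of `R` with respect to `x`. -/
abbrev KoszulHomology (i : ℕ) : Type u :=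
  koszulCycles x i ⧸ (koszulBoundaries x i).submoduleOf (koszulCycles x i)

end Koszul

/-- A strongly Cohen-Macaulay ideal of a (Noetherian) local ring: all homology modules of the
Koszul complex of `R` with respect to a finite generating sequence of `I` are Cohen-Macaulay.
(Whether they are does not depend on the choice of the generating sequence.) -/
def IsStronglyCohenMacaulay {R : Type u} [CommRing R] [IsLocalRing R] (I : Ideal R) : Prop :=
  ∃ (n : ℕ) (x : Fin n → R), Ideal.span (Set.range x) = I ∧
    ∀ i : ℕ, IsCohenMacaulayModule R (KoszulHomology x i)

/-! If Ann(I) = 0, the quotient is R itself. Otherwise an associated prime p of Ann(I) is associated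
to R and contains I. Since R is Cohen–Macaulay, dim R/p ≥ dim R
(`length_le_supportDim_quotient_of_mem_associatedPrimes`), hence dim R/I = dim R, and R/I, being the
Koszul homology H_0, is maximal Cohen–Macaulay. For I ≠ 0, dualize 0 → I → R → R/I → 0 into R. As
Ext^i(R/I, R) = 0 for i > 0, the map R → Hom(I, R) is onto with kernel Ann(I), and Ext^i(I, R) = 0
for i > 0, so R-regular sequences stay regular on Hom(I, R) ≅ R/Ann(I)
(`isWeaklyRegular_linearMap`).

The vanishing rests on Ext^i(-, R) = 0 on finite modules for i > d = dim R
(`IsGorensteinRing.subsingleton_ext`). The quotient of R by a regular sequence of length d has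
projective dimension d and contains the residue field k; descending induction from the finite
injective dimension kills Ext^i(k, R), and prime filtrations do the rest. A regular sequence of
length d on R/I then lowers the bound to i > 0. -/

open CategoryTheory Abelian IsLocalRing RingTheory.Sequence Pointwise

/-! ### Vanishing of Ext on finite modules -/

section ExtVanishing

variable {R : Type u} [CommRing R]

/-- If `Ext¹(X, S.X₁) = 0`, morphisms from `X` lift along the epimorphism of a short exact
sequence `S`. -/
lemma exists_lift_of_subsingleton_ext_one {S : ShortComplex (ModuleCat.{u} R)} (hS : S.ShortExact)
    (X : ModuleCat.{u} R) (h : Subsingleton (Ext X S.X₁ 1)) (f : X ⟶ S.X₃) :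
    ∃ g : X ⟶ S.X₂, g ≫ S.g = f := by
  obtain ⟨g', hg'⟩ := Ext.covariant_sequence_exact₃ X hS (Ext.mk₀ f) (zero_add 1)
    (Subsingleton.elim _ _)
  obtain ⟨g, rfl⟩ := (Ext.mk₀_bijective X S.X₂).2 g'
  rw [Ext.mk₀_comp_mk₀, (Ext.mk₀_bijective _ _).1.eq_iff] at hg'
  exact ⟨g, hg'⟩

/-- If `Ext¹(S.X₃, Y) = 0`, morphisms to `Y` extend along the monomorphism of a short exact
sequence `S`. -/
lemma exists_extension_of_subsingleton_ext_one {S : ShortComplex (ModuleCat.{u} R)}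
    (hS : S.ShortExact) (Y : ModuleCat.{u} R) (h : Subsingleton (Ext S.X₃ Y 1)) (f : S.X₁ ⟶ Y) :
    ∃ g : S.X₂ ⟶ Y, S.f ≫ g = f := by
  obtain ⟨g', hg'⟩ := Ext.contravariant_sequence_exact₁ hS Y (Ext.mk₀ f) (add_zero 1)
    (Subsingleton.elim _ _)
  obtain ⟨g, rfl⟩ := (Ext.mk₀_bijective S.X₂ Y).2 g'
  rw [Ext.mk₀_comp_mk₀, (Ext.mk₀_bijective _ _).1.eq_iff] at hg'
  exact ⟨g, hg'⟩

lemma subsingleton_ext_covariant₃ {S : ShortComplex (ModuleCat.{u} R)} (hS : S.ShortExact)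
    (X : ModuleCat.{u} R) (i : ℕ) (h₂ : Subsingleton (Ext X S.X₂ i))
    (h₁ : Subsingleton (Ext X S.X₁ (i + 1))) : Subsingleton (Ext X S.X₃ i) := by
  refine subsingleton_of_forall_eq 0 fun a ↦ ?_
  obtain ⟨b, rfl⟩ := Ext.covariant_sequence_exact₃ X hS a rfl (Subsingleton.elim _ _)
  rw [Subsingleton.elim b 0, Ext.zero_comp]

lemma subsingleton_ext_contravariant₁ {S : ShortComplex (ModuleCat.{u} R)} (hS : S.ShortExact)
    (Y : ModuleCat.{u} R) (i : ℕ) (h₂ : Subsingleton (Ext S.X₂ Y i))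
    (h₃ : Subsingleton (Ext S.X₃ Y (i + 1))) : Subsingleton (Ext S.X₁ Y i) := by
  refine subsingleton_of_forall_eq 0 fun a ↦ ?_
  obtain ⟨b, rfl⟩ := Ext.contravariant_sequence_exact₁ hS Y a (add_comm 1 i)
    (Subsingleton.elim _ _)
  rw [Subsingleton.elim b 0, Ext.comp_zero]

lemma subsingleton_ext_contravariant₂ {S : ShortComplex (ModuleCat.{u} R)} (hS : S.ShortExact)
    (Y : ModuleCat.{u} R) (i : ℕ) (h₁ : Subsingleton (Ext S.X₁ Y i))
    (h₃ : Subsingleton (Ext S.X₃ Y i)) : Subsingleton (Ext S.X₂ Y i) := by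
  refine subsingleton_of_forall_eq 0 fun a ↦ ?_
  obtain ⟨b, rfl⟩ := Ext.contravariant_sequence_exact₂ hS Y a (Subsingleton.elim _ _)
  rw [Subsingleton.elim b 0, Ext.comp_zero]

/-- Vanishing of `Ext(-, Y)` depends only on the isomorphism class of the module. -/
lemma subsingleton_ext_of_linearEquiv {M N : Type u} [AddCommGroup M] [Module R M]
    [AddCommGroup N] [Module R N] (e : M ≃ₗ[R] N) (Y : ModuleCat.{u} R) (i : ℕ)
    (h : Subsingleton (Ext (ModuleCat.of R N) Y i)) :
    Subsingleton (Ext (ModuleCat.of R M) Y i) := by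
  refine subsingleton_of_forall_eq 0 fun a ↦ ?_
  have h1 : (Ext.mk₀ e.toModuleIso.inv).comp a (zero_add i) = 0 := Subsingleton.elim _ _
  have h2 := congrArg (fun b ↦ (Ext.mk₀ e.toModuleIso.hom).comp b (zero_add i)) h1
  simpa only [Ext.mk₀_comp_mk₀_assoc, Iso.hom_inv_id, Ext.mk₀_id_comp, Ext.comp_zero] using h2

variable [IsLocalRing R] [IsNoetherianRing R]

/-- By Nakayama's lemma, `Ext(M, N)` vanishes in degree `i` if `Ext(M / xM, N)` vanishes in degree
`i + 1` for some `M`-regular element `x` of the maximal ideal. -/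
lemma subsingleton_ext_of_quotSMulTop {M : ModuleCat.{u} R} [Module.Finite R M]
    (N : ModuleCat.{u} R) [Module.Finite R N] {x : R} (reg : IsSMulRegular M x)
    (mem : x ∈ maximalIdeal R) (i : ℕ)
    (h : Subsingleton (Ext (ModuleCat.of R (QuotSMulTop x M)) N (i + 1))) :
    Subsingleton (Ext M N i) := by
  by_contra ntr
  rw [not_subsingleton_iff_nontrivial] at ntr
  -- The long exact sequence of multiplication by x on M makes x surjective on the finite module
  -- Ext(M, N).
  refine Submodule.top_ne_pointwise_smul_of_mem_jacobson_annihilator (R := R) (M := Ext M N i)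
    (maximalIdeal_le_jacobson _ mem) (eq_comm.mp (eq_top_iff.mpr fun y _ ↦ ?_))
  obtain ⟨z, hz⟩ := Ext.contravariant_sequence_exact₁ reg.smulShortComplex_shortExact N y
    (add_comm 1 i) (h.elim _ _)
  replace hz : (Ext.mk₀ (x • 𝟙 M)).comp (show Ext M N i from z) (zero_add i) = y := hz
  rw [Ext.mk₀_smul, Ext.smul_comp, Ext.mk₀_id_comp] at hz
  rw [← hz]
  exact Submodule.smul_mem_pointwise_smul _ x ⊤ trivial

/-- If `Ext(-, N)` vanishes on finite modules in degree `i + 1`, and it kills the residue field in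
degree `i`, then it vanishes on finite modules in degree `i`. -/
lemma subsingleton_ext_of_residueField (N : ModuleCat.{u} R) [Module.Finite R N] (i : ℕ)
    (h : ∀ M : ModuleCat.{u} R, Module.Finite R M → Subsingleton (Ext M N (i + 1)))
    (hk : Subsingleton (Ext (ModuleCat.of R (R ⧸ maximalIdeal R)) N i))
    (M : ModuleCat.{u} R) [Module.Finite R M] : Subsingleton (Ext M N i) := by
  refine IsNoetherianRing.induction_on_isQuotientEquivQuotientPrime (A := R) (M := M)
    (motive := fun L _ _ _ ↦ Subsingleton (Ext (ModuleCat.of R L) N i)) inferInstance ?_ ?_ ?_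
  · intro L _ _ _ _
    have h0 : Limits.IsZero (ModuleCat.of R L) := ModuleCat.isZero_of_subsingleton _
    refine subsingleton_of_forall_eq 0 fun a ↦ ?_
    rw [← Ext.mk₀_id_comp a, h0.eq_of_src (𝟙 _) 0, Ext.mk₀_zero, Ext.zero_comp]
  · intro L _ _ _ p e
    refine subsingleton_ext_of_linearEquiv e N i ?_
    by_cases hp : p.1 = maximalIdeal R
    · rwa [hp]
    -- Such an x is regular on the domain R/p, so degree i + 1 controls degree i.
    obtain ⟨x, hx, hxp⟩ : ∃ x ∈ maximalIdeal R, x ∉ p.1 := by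
      by_contra! H
      exact hp ((le_maximalIdeal p.2.ne_top).antisymm H)
    refine subsingleton_ext_of_quotSMulTop (M := ModuleCat.of R (R ⧸ p.1)) N (x := x) ?_ hx i
      (h _ (inferInstanceAs (Module.Finite R (QuotSMulTop x (R ⧸ p.1)))))
    exact isSMulRegular_iff_right_eq_zero_of_smul.mpr fun y hy ↦ by
      rw [Algebra.smul_def, mul_eq_zero] at hy
      exact hy.resolve_left fun h0 ↦ hxp (Ideal.Quotient.eq_zero_iff_mem.mp h0)
  · intro N₁ _ _ _ N₂ _ _ _ N₃ _ _ _ f g hf hg hfg h₁ h₃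
    exact subsingleton_ext_contravariant₂ (ModuleCat.shortComplex_shortExact
      (ModuleCat.shortComplexOfCompEqZero f g hfg.linearMap_comp_eq_zero) hfg hf hg) N i h₁ h₃

/-- If `N` has finite injective dimension and the residue field embeds into a finite module `Q`,
then `Ext(-, N)` vanishes on finite modules in the degrees `≥ n` in which it vanishes on `Q`. -/
lemma subsingleton_ext_of_residueField_embeds (N : ModuleCat.{u} R) [Module.Finite R N] (m : ℕ)
    [HasInjectiveDimensionLT N m] (Q : Type u) [AddCommGroup Q] [Module R Q] [Module.Finite R Q]
    (f : (R ⧸ maximalIdeal R) →ₗ[R] Q) (hf : Function.Injective f) (n : ℕ)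
    (hQ : ∀ i, n ≤ i → Subsingleton (Ext (ModuleCat.of R Q) N i)) (i : ℕ) (hi : n ≤ i)
    (M : ModuleCat.{u} R) [Module.Finite R M] : Subsingleton (Ext M N i) := by
  obtain him | him := le_total m i
  · exact HasInjectiveDimensionLT.subsingleton N m i him M
  induction him using Nat.decreasingInduction generalizing M with
  | self => exact HasInjectiveDimensionLT.subsingleton N m m le_rfl M
  | of_succ j hj ih =>
    have h : ∀ M : ModuleCat.{u} R, Module.Finite R M → Subsingleton (Ext M N (j + 1)) :=
      fun M _ ↦ ih (hi.trans j.le_succ) M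
    refine subsingleton_ext_of_residueField N j h ?_ M
    -- In 0 → k → Q → Q/k → 0, Ext^j(k, N) sits between Ext^j(Q, N) and Ext^(j+1)(Q/k, N).
    have hex : Function.Exact f (LinearMap.range f).mkQ := LinearMap.exact_map_mkQ_range f
    exact subsingleton_ext_contravariant₁ (ModuleCat.shortComplex_shortExact
      (ModuleCat.shortComplexOfCompEqZero f _ hex.linearMap_comp_eq_zero) hex hf
      (Submodule.mkQ_surjective _)) N j (hQ j hi)
      (h _ (inferInstanceAs (Module.Finite R (Q ⧸ LinearMap.range f))))

/-- A regular sequence on `M` lowers the degrees in which `Ext(M, N)` may be nonzero. -/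
lemma subsingleton_ext_of_isWeaklyRegular (N : ModuleCat.{u} R) [Module.Finite R N] (n : ℕ)
    (h : ∀ i, n ≤ i → ∀ M : ModuleCat.{u} R, Module.Finite R M → Subsingleton (Ext M N i))
    (rs : List R) (mem : ∀ r ∈ rs, r ∈ maximalIdeal R) (M : ModuleCat.{u} R) [Module.Finite R M]
    (reg : IsWeaklyRegular M rs) (i : ℕ) (hi : n ≤ i + rs.length) :
    Subsingleton (Ext M N i) := by
  induction rs generalizing M i with
  | nil => exact h i hi M ‹_›
  | cons r rs ih =>
    rw [isWeaklyRegular_cons_iff] at reg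
    rw [List.forall_mem_cons] at mem
    rw [List.length_cons] at hi
    have : Module.Finite R (ModuleCat.of R (QuotSMulTop r M)) :=
      inferInstanceAs (Module.Finite R (QuotSMulTop r M))
    exact subsingleton_ext_of_quotSMulTop N reg.1 mem.1 i
      (ih mem.2 (ModuleCat.of R (QuotSMulTop r M)) reg.2 (i + 1) (by lia))

end ExtVanishing

/-! ### Koszul homology in degree zero -/

section Koszul

/-- The Koszul homology in degree zero is the quotient by the ideal generated by the sequence. -/
noncomputable def koszulHomologyZeroEquiv {R : Type u} [CommRing R] {n : ℕ} (x : Fin n → R) :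
    (R ⧸ Ideal.span (Set.range x)) ≃ₗ[R] KoszulHomology x 0 :=
  let φ : R →ₗ[R] koszulCycles x 0 :=
    (Algebra.linearMap R (ExteriorAlgebra R (Fin n → R))).codRestrict _ fun r ↦
      ⟨CliffordAlgebra.contractLeft_algebraMap (Q := 0) (Fintype.linearCombination R x) r, by
        rw [ExteriorAlgebra.exteriorPower, pow_zero]; exact Submodule.algebraMap_mem r⟩
  (Submodule.quotEquivOfEq _ _ (by
    ext r
    rw [LinearMap.ker_comp, Submodule.ker_mkQ, Submodule.mem_comap, Submodule.submoduleOf,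
      Submodule.mem_comap, Ideal.span, Submodule.mem_span_range_iff_exists_fun]
    simp only [koszulBoundaries, zero_add, ExteriorAlgebra.exteriorPower, pow_one,
      Submodule.mem_map, LinearMap.mem_range, exists_exists_eq_and]
    -- On degree one the differential is the defining linear form, so its image is the ideal itself.
    have key (v : Fin n → R) : koszulDifferential x (ExteriorAlgebra.ι R v) =
        algebraMap R _ (∑ j, v j * x j) := by
      have h := koszulDifferential_ι_mul x v 1
      rw [mul_one] at h
      rw [h, koszulDifferential, CliffordAlgebra.contractLeft_one, mul_zero, sub_zero,
        Algebra.algebraMap_eq_smul_one]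
    simp only [key, smul_eq_mul]
    exact exists_congr fun v ↦ (ExteriorAlgebra.algebraMap_leftInverse _).injective.eq_iff.symm)).trans
    (LinearMap.quotKerEquivOfSurjective
      ((((koszulBoundaries x 0).submoduleOf (koszulCycles x 0)).mkQ).comp φ) (by
        refine (Submodule.mkQ_surjective _).comp ?_
        rintro ⟨b, hb, hb'⟩
        rw [SetLike.mem_coe, ExteriorAlgebra.exteriorPower, pow_zero, Submodule.mem_one] at hb'
        obtain ⟨r, hr⟩ := hb'
        exact ⟨r, Subtype.ext hr⟩))

end Koszul

/-! ### Regular sequences on Hom modules -/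

section HomRegular

variable {R : Type u} [CommRing R]

/-- If the higher `Ext(M, N)` vanish, then `N`-regular sequences are `Hom(M, N)`-regular. -/
lemma isWeaklyRegular_linearMap (M : Type u) [AddCommGroup M] [Module R M] (rs : List R)
    (N : Type u) [AddCommGroup N] [Module R N]
    (h : ∀ i, Subsingleton (Ext (ModuleCat.of R M) (ModuleCat.of R N) (i + 1)))
    (reg : IsWeaklyRegular N rs) : IsWeaklyRegular (M →ₗ[R] N) rs := by
  induction rs generalizing N with
  | nil => exact .nil R _
  | cons r rs ih =>
    rw [isWeaklyRegular_cons_iff] at reg ⊢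
    have hr : IsSMulRegular (M →ₗ[R] N) r := fun f g hfg ↦
      LinearMap.ext fun m ↦ reg.1 (LinearMap.congr_fun hfg m)
    refine ⟨hr, ?_⟩
    have hS := IsSMulRegular.smulShortComplex_shortExact (M := ModuleCat.of R N) reg.1
    let φ : (M →ₗ[R] N) →ₗ[R] (M →ₗ[R] QuotSMulTop r N) :=
      LinearMap.compRight R (Submodule.mkQ _)
    have hφ : Function.Surjective φ := fun f ↦ by
      obtain ⟨g, hg⟩ := exists_lift_of_subsingleton_ext_one hS (ModuleCat.of R M) (h 0)
        (ModuleCat.ofHom f)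
      exact ⟨g.hom, congrArg ModuleCat.Hom.hom hg⟩
    have hker : r • (⊤ : Submodule R (M →ₗ[R] N)) = LinearMap.ker φ := by
      ext f
      rw [Submodule.mem_smul_pointwise_iff_exists, LinearMap.mem_ker]
      constructor
      · rintro ⟨g, -, rfl⟩
        ext m
        exact (Submodule.Quotient.mk_eq_zero _).mpr
          (Submodule.smul_mem_pointwise_smul (g m) r ⊤ trivial)
      · intro hf
        have hm (m : M) : ∃ n : N, r • n = f m := by
          have := (Submodule.Quotient.mk_eq_zero _).mp (LinearMap.congr_fun hf m)
          obtain ⟨n, -, hn⟩ := (Submodule.mem_smul_pointwise_iff_exists _ _ _).mp this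
          exact ⟨n, hn⟩
        -- Division by r is unique because r is regular on N, which forces g to be linear.
        choose g hg using hm
        refine ⟨⟨⟨g, fun a b ↦ reg.1 ?_⟩, fun a b ↦ reg.1 ?_⟩, trivial, LinearMap.ext hg⟩
        · simp only [smul_add, hg, map_add]
        · simp only [RingHom.id_apply, smul_comm r a, hg, map_smul]
    refine ((Submodule.quotEquivOfEq _ _ hker).trans
      (φ.quotKerEquivOfSurjective hφ)).isWeaklyRegular_congr rs |>.mpr (ih (QuotSMulTop r N) ?_ reg.2)
    exact fun i ↦ subsingleton_ext_covariant₃ hS (ModuleCat.of R M) (i + 1) (h i) (h (i + 1))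

end HomRegular

/-! ### Depth, dimension and associated primes -/

section Depth

variable {R : Type u} [CommRing R] [IsLocalRing R]

lemma moduleDepth_eq_of_linearEquiv {M : Type*} {N : Type*} [AddCommGroup M] [Module R M]
    [AddCommGroup N] [Module R N] (e : M ≃ₗ[R] N) : moduleDepth R M = moduleDepth R N := by
  simp only [moduleDepth, e.isRegular_congr]

lemma IsCohenMacaulayModule.of_linearEquiv {M : Type*} {N : Type*} [AddCommGroup M] [Module R M]
    [AddCommGroup N] [Module R N] (e : M ≃ₗ[R] N) (h : IsCohenMacaulayModule R M) :
    IsCohenMacaulayModule R N where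
  finite := have := h.finite; Module.Finite.equiv e
  depth_eq_dim _ := by
    rw [← moduleDepth_eq_of_linearEquiv e, ← Module.supportDim_eq_of_equiv e]
    exact h.depth_eq_dim e.toEquiv.nontrivial

variable [IsNoetherianRing R]

lemma length_le_supportDim_of_isRegular {M : Type*} [AddCommGroup M] [Module R M]
    [Module.Finite R M] {rs : List R} (reg : IsRegular M rs) :
    (rs.length : WithBot ℕ∞) ≤ Module.supportDim R M := by
  rw [← Module.supportDim_add_length_eq_supportDim_of_isRegular rs reg]
  have := reg.quot_ofList_smul_nontrivial ⊤
  have h : 0 ≤ Module.supportDim R (M ⧸ Ideal.ofList rs • (⊤ : Submodule R M)) := by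
    have h0 := Module.supportDim_ne_bot_of_nontrivial R (M ⧸ Ideal.ofList rs • (⊤ : Submodule R M))
    rw [← WithBot.coe_unbot _ h0]
    exact WithBot.coe_le_coe.mpr zero_le
  simpa using add_le_add_left h (rs.length : WithBot ℕ∞)

/-- A nonzero Cohen-Macaulay module has a regular sequence whose length is its dimension. -/
lemma IsCohenMacaulayModule.exists_isRegular {M : Type*} [AddCommGroup M] [Module R M]
    [Nontrivial M] (h : IsCohenMacaulayModule R M) : ∃ rs : List R, IsRegular M rs ∧
      (∀ r ∈ rs, r ∈ maximalIdeal R) ∧ (rs.length : WithBot ℕ∞) = Module.supportDim R M := by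
  have := h.finite
  have hd := h.depth_eq_dim ‹_›
  -- A supremum in `ℕ∞` is attained once it is finite.
  have hfin : moduleDepth R M < ⊤ := by
    have h1 : Module.supportDim R M < ⊤ :=
      (Module.supportDim_le_ringKrullDim R M).trans_lt ringKrullDim_lt_top
    rw [← hd] at h1
    exact WithBot.coe_lt_coe.mp h1
  have hne : Nonempty {rs : List R // IsRegular M rs ∧ ∀ r ∈ rs, r ∈ maximalIdeal R} :=
    ⟨⟨[], .nil R M, by simp⟩⟩
  rw [← hd]
  rw [moduleDepth, iSup_subtype'] at hfin ⊢
  obtain ⟨⟨rs, h1, h2⟩, h3⟩ := ENat.exists_eq_iSup_of_lt_top hfin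
  exact ⟨rs, h1, h2, congrArg _ h3⟩

/-- A finite module with a regular sequence of length `dim R` is maximal Cohen-Macaulay. -/
lemma IsMaximalCohenMacaulayModule.of_isRegular {M : Type*} [AddCommGroup M] [Module R M]
    [Module.Finite R M] {rs : List R} (reg : IsRegular M rs)
    (mem : ∀ r ∈ rs, r ∈ maximalIdeal R) (hlen : (rs.length : WithBot ℕ∞) = ringKrullDim R) :
    IsMaximalCohenMacaulayModule R M := by
  have hdim : Module.supportDim R M = ringKrullDim R :=
    (Module.supportDim_le_ringKrullDim R M).antisymm
      (hlen ▸ length_le_supportDim_of_isRegular reg)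
  refine ⟨⟨‹_›, fun _ ↦ le_antisymm ?_ ?_⟩, fun _ ↦ hdim⟩
  · have h0 := Module.supportDim_ne_bot_of_nontrivial R M
    rw [← WithBot.coe_unbot _ h0]
    refine WithBot.coe_le_coe.mpr (iSup₂_le fun ss hs ↦ WithBot.coe_le_coe.mp ?_)
    rw [WithBot.coe_unbot]
    exact length_le_supportDim_of_isRegular hs.1
  · rw [hdim, ← hlen]
    exact WithBot.coe_le_coe.mpr (le_iSup₂_of_le rs ⟨reg, mem⟩ le_rfl)

/-- The length of an `M`-regular sequence is at most the dimension of each associated prime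
of `M`. -/
lemma length_le_supportDim_quotient_of_mem_associatedPrimes (rs : List R) (M : Type u)
    [AddCommGroup M] [Module R M] [Module.Finite R M] (reg : IsRegular M rs)
    (mem : ∀ r ∈ rs, r ∈ maximalIdeal R) (p : Ideal R) (hp : p ∈ associatedPrimes R M) :
    (rs.length : WithBot ℕ∞) ≤ Module.supportDim R (R ⧸ p) := by
  induction rs generalizing M p with
  | nil =>
    have := hp.isPrime
    have : Nontrivial (R ⧸ p) := Ideal.Quotient.nontrivial_iff.mpr this.ne_top
    exact length_le_supportDim_of_isRegular (.nil R (R ⧸ p))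
  | cons x rs ih =>
    rw [isRegular_cons_iff] at reg
    rw [List.forall_mem_cons] at mem
    have hpp := hp.isPrime
    obtain ⟨-, a, ha⟩ := isAssociatedPrime_iff.mp (AssociatedPrimes.mem_iff.mp hp)
    have hxp : x ∉ p := fun hx ↦ by
      rw [ha, Submodule.mem_colon_singleton, Submodule.mem_bot] at hx
      have ha0 : a = 0 := reg.1.right_eq_zero_of_smul hx
      refine hpp.ne_top (ha.trans ?_)
      simp [ha0]
    let T : Submodule R M := Submodule.torsionBySet R M p
    have haT : a ∈ T := (Submodule.mem_torsionBySet_iff _ _).mpr fun ⟨r, hr⟩ ↦ by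
      simp only [SetLike.mem_coe] at hr
      rw [ha, Submodule.mem_colon_singleton, Submodule.mem_bot] at hr
      exact hr
    -- If T ⊆ xM, then T = xT, since x is regular and cancels from the relations p·(xc) = 0;
    -- Nakayama gives T = 0.
    obtain ⟨b, hbT, hb⟩ : ∃ b ∈ T, b ∉ x • (⊤ : Submodule R M) := by
      by_contra! H
      have hT : T ≤ maximalIdeal R • T := fun b hb ↦ by
        obtain ⟨c, -, rfl⟩ := (Submodule.mem_smul_pointwise_iff_exists _ _ _).mp (H b hb)
        refine Submodule.smul_mem_smul mem.1 ((Submodule.mem_torsionBySet_iff _ _).mpr fun r ↦ ?_)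
        refine reg.1.right_eq_zero_of_smul ?_
        rw [smul_comm]
        exact (Submodule.mem_torsionBySet_iff _ _).mp hb r
      have hT0 : T = ⊥ := Submodule.eq_bot_of_le_smul_of_le_jacobson_bot _ T
        (IsNoetherian.noetherian T) hT (maximalIdeal_le_jacobson _)
      have ha0 : a = 0 := by rwa [hT0, Submodule.mem_bot] at haT
      refine hpp.ne_top (ha.trans ?_)
      simp [ha0]
    let c : QuotSMulTop x M := Submodule.Quotient.mk b
    have hc : c ≠ 0 := fun h ↦ hb ((Submodule.Quotient.mk_eq_zero _).mp h)
    -- The class of b is killed by p and by x, so q contains both and R/q is a quotient of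
    -- (R/p)/x(R/p), of dimension one less than R/p.
    obtain ⟨q, hq, hcq⟩ := exists_le_isAssociatedPrime_of_isNoetherianRing R c hc
    have hqx : x ∈ q := hcq (by
      rw [Submodule.mem_colon_singleton, Submodule.mem_bot]
      exact (Submodule.Quotient.mk_eq_zero _).mpr (Submodule.smul_mem_pointwise_smul b x ⊤ trivial))
    have hpq : p ≤ q := fun r hr ↦ hcq (by
      rw [Submodule.mem_colon_singleton, Submodule.mem_bot]
      have : r • b = 0 := (Submodule.mem_torsionBySet_iff _ _).mp hbT ⟨r, hr⟩
      rw [← Submodule.Quotient.mk_smul, this, Submodule.Quotient.mk_zero])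
    have hreg : IsSMulRegular (R ⧸ p) x :=
      isSMulRegular_iff_right_eq_zero_of_smul.mpr fun y hy ↦ by
        rw [Algebra.smul_def, mul_eq_zero] at hy
        exact hy.resolve_left fun h0 ↦ hxp (Ideal.Quotient.eq_zero_iff_mem.mp h0)
    rw [← Module.supportDim_quotSMulTop_succ_eq_supportDim hreg mem.1, List.length_cons,
      Nat.cast_add, Nat.cast_one]
    refine add_le_add_left ((ih (QuotSMulTop x M) reg.2 mem.2 q hq).trans ?_) 1
    let π : QuotSMulTop x (R ⧸ p) →ₗ[R] R ⧸ q :=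
      Submodule.liftQ _ (Submodule.factor hpq) (by
        rintro _ hy
        obtain ⟨z, -, rfl⟩ := (Submodule.mem_smul_pointwise_iff_exists _ _ _).mp hy
        rw [LinearMap.mem_ker, map_smul, Algebra.smul_def]
        exact (congrArg (· * _) (Ideal.Quotient.eq_zero_iff_mem.mpr hqx)).trans (zero_mul _))
    refine Module.supportDim_le_of_surjective π fun y ↦ ?_
    obtain ⟨z, rfl⟩ := Submodule.factor_surjective hpq y
    exact ⟨Submodule.Quotient.mk z, rfl⟩

/-- The residue field embeds into every nonzero finite module of dimension zero. -/
lemma exists_residueField_injective_of_supportDim_eq_zero (M : Type*) [AddCommGroup M]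
    [Module R M] [Module.Finite R M] (h : Module.supportDim R M = 0) :
    ∃ f : (R ⧸ maximalIdeal R) →ₗ[R] M, Function.Injective f := by
  have : Nontrivial M := by
    rw [← Module.supportDim_ne_bot_iff_nontrivial R, h]; exact WithBot.coe_ne_bot
  obtain ⟨p, hp⟩ := associatedPrimes.nonempty R M
  have hsupp : (⟨p, hp.isPrime⟩ : PrimeSpectrum R) ∈ Module.support R M :=
    Module.mem_support_iff_of_finite.mpr
      (Submodule.annihilator_top.symm.trans_le hp.annihilator_le)
  rw [support_of_supportDim_eq_zero R M h] at hsupp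
  have hpm : p = maximalIdeal R := (le_maximalIdeal hp.isPrime.ne_top).antisymm hsupp
  rw [← hpm]
  exact ((isAssociatedPrime_iff_exists_injective_linearMap p M).mp
    (AssociatedPrimes.mem_iff.mp hp)).2

end Depth

/-! ### Duality over a Gorenstein ring -/

section Gorenstein

variable {R : Type u} [CommRing R] [IsNoetherianRing R] [IsLocalRing R]

/-- Over a Gorenstein Cohen-Macaulay local ring of dimension `d`, `Ext(-, R)` vanishes on finite
modules in degrees `> d`. -/
lemma IsGorensteinRing.subsingleton_ext (hG : IsGorensteinRing R) {rs : List R}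
    (reg : IsRegular R rs) (hlen : (rs.length : WithBot ℕ∞) = ringKrullDim R) (i : ℕ)
    (hi : rs.length + 1 ≤ i) (M : ModuleCat.{u} R) [Module.Finite R M] :
    Subsingleton (Ext M (ModuleCat.of R R) i) := by
  obtain ⟨m, hm⟩ := (injectiveDimension_ne_top_iff _).mp hG
  have hdim : Module.supportDim R (R ⧸ Ideal.ofList rs) = 0 := by
    have h := ringKrullDim_add_length_eq_ringKrullDim_of_isRegular rs reg
    rw [Module.supportDim_quotient_eq_ringKrullDim]
    refine (ENat.WithBot.add_natCast_cancel (c := rs.length)).mp ?_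
    rw [h, hlen, zero_add]
  obtain ⟨f, hf⟩ := exists_residueField_injective_of_supportDim_eq_zero (R ⧸ Ideal.ofList rs) hdim
  refine subsingleton_ext_of_residueField_embeds (ModuleCat.of R R) (m + 1) (R ⧸ Ideal.ofList rs)
    f hf (rs.length + 1) (fun j hj ↦ ?_) i hi M
  have hpd : HasProjectiveDimensionLT (ModuleCat.of R (Shrink.{u} (R ⧸ Ideal.ofList rs)))
      (rs.length + 1) :=
    (projectiveDimension_le_iff _ _).mp (ModuleCat.projectiveDimension_quotient_eq_length rs reg).le
  exact subsingleton_ext_of_linearEquiv (Shrink.linearEquiv R _).symm _ j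
    (HasProjectiveDimensionLT.subsingleton _ _ j hj _)

/-- Linkage by the zero ideal: if `R` is a Gorenstein Cohen-Macaulay local ring and `R ⧸ I` is
maximal Cohen-Macaulay, then so is `R ⧸ Ann(I)`. -/
lemma IsGorensteinRing.isMaximalCohenMacaulayModule_quotient_annihilator
    (hG : IsGorensteinRing R) {rs ss : List R} (reg : IsRegular R rs)
    (hrs : ∀ r ∈ rs, r ∈ maximalIdeal R) (hlen : (rs.length : WithBot ℕ∞) = ringKrullDim R)
    (I : Ideal R) (hI : I ≠ ⊥) (hreg : IsRegular (R ⧸ I) ss) (hss : ∀ r ∈ ss, r ∈ maximalIdeal R)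
    (hle : rs.length ≤ ss.length) :
    IsMaximalCohenMacaulayModule R (R ⧸ Module.annihilator R I) := by
  have hext (i : ℕ) : Subsingleton (Ext (ModuleCat.of R (R ⧸ I)) (ModuleCat.of R R) (i + 1)) :=
    subsingleton_ext_of_isWeaklyRegular (ModuleCat.of R R) (rs.length + 1)
      (fun j hj M _ ↦ hG.subsingleton_ext reg hlen j hj M) ss hss (ModuleCat.of R (R ⧸ I))
      hreg.1 (i + 1) (by lia)
  have hex : Function.Exact I.subtype I.mkQ := LinearMap.exact_subtype_mkQ I
  have hS := ModuleCat.shortComplex_shortExact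
    (ModuleCat.shortComplexOfCompEqZero I.subtype I.mkQ hex.linearMap_comp_eq_zero) hex
    I.injective_subtype I.mkQ_surjective
  -- Ext^(i+1)(I, R) lies between Ext^(i+1)(R, R) = 0 and Ext^(i+2)(R/I, R) = 0.
  have hextI (i : ℕ) : Subsingleton (Ext (ModuleCat.of R I) (ModuleCat.of R R) (i + 1)) :=
    subsingleton_ext_contravariant₁ hS _ (i + 1)
      (HasProjectiveDimensionLT.subsingleton (ModuleCat.of R R) 1 (i + 1) (by lia) _)
      (hext (i + 1))
  let φ : R →ₗ[R] (I →ₗ[R] R) := LinearMap.toSpanSingleton R _ I.subtype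
  -- A map I → R extends to R, where it is multiplication by the image of 1.
  have hφ : Function.Surjective φ := fun f ↦ by
    obtain ⟨g, hg⟩ := exists_extension_of_subsingleton_ext_one hS (ModuleCat.of R R) (hext 0)
      (ModuleCat.ofHom f)
    refine ⟨g.hom 1, LinearMap.ext fun a ↦ ?_⟩
    have h : f a = g.hom (a : R) := (LinearMap.congr_fun (congrArg ModuleCat.Hom.hom hg) a).symm
    rw [h, ← mul_one (a : R), ← smul_eq_mul, map_smul]
    simp [φ, mul_comm]
  have hker : Module.annihilator R I = LinearMap.ker φ := by
    ext r
    rw [Module.mem_annihilator, LinearMap.mem_ker, LinearMap.ext_iff]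
    refine forall_congr' fun a ↦ ?_
    rw [Subtype.ext_iff]
    rfl
  let e := (Submodule.quotEquivOfEq _ _ hker).trans (φ.quotKerEquivOfSurjective hφ)
  have hnt : Nontrivial (R ⧸ Module.annihilator R I) := by
    rw [Ideal.Quotient.nontrivial_iff, Ne, Module.annihilator_eq_top_iff]
    rwa [Submodule.subsingleton_iff_eq_bot]
  have hw := (e.isWeaklyRegular_congr rs).mpr (isWeaklyRegular_linearMap I rs R hextI reg.1)
  exact .of_isRegular (.of_isWeaklyRegular_of_mem_maximalIdeal _ hrs hw) hrs hlen

end Gorenstein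

theorem theorem2p5 {R : Type u} [CommRing R] [IsNoetherianRing R] [IsLocalRing R]
    (hCM : IsCohenMacaulayModule R R) (hG : IsGorensteinRing R)
    (I : Ideal R) (hI : IsStronglyCohenMacaulay I) :
    IsMaximalCohenMacaulayModule R (R ⧸ Module.annihilator R I) := by
  obtain ⟨rs, reg, hrs, hlen⟩ := hCM.exists_isRegular
  rw [Module.supportDim_self_eq_ringKrullDim] at hlen
  obtain hA | hA := subsingleton_or_nontrivial (Module.annihilator R I)
  · rw [Submodule.subsingleton_iff_eq_bot] at hA
    have e : (R ⧸ Module.annihilator R I) ≃ₗ[R] R := Submodule.quotEquivOfEqBot _ hA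
    have := Module.Finite.equiv e.symm
    exact .of_isRegular ((e.isRegular_congr rs).mpr reg) hrs hlen
  obtain ⟨n, x, hx, hK⟩ := hI
  have hH : IsCohenMacaulayModule R (R ⧸ I) :=
    .of_linearEquiv (((koszulHomologyZeroEquiv x).symm).trans (Submodule.quotEquivOfEq _ _ hx))
      (hK 0)
  obtain ⟨p, hp⟩ := associatedPrimes.nonempty R (Module.annihilator R I)
  obtain ⟨hpp, a, ha⟩ := isAssociatedPrime_iff.mp (AssociatedPrimes.mem_iff.mp hp)
  have hIp : I ≤ p := fun r hr ↦ by
    rw [ha, Submodule.mem_colon_singleton, Submodule.mem_bot]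
    refine Subtype.ext ?_
    have h := congrArg Subtype.val (Module.mem_annihilator.mp a.2 ⟨r, hr⟩)
    simpa [mul_comm] using h
  have hpR : p ∈ associatedPrimes R R :=
    associatedPrimes.subset_of_injective (Submodule.injective_subtype _) hp
  have hdim : (rs.length : WithBot ℕ∞) ≤ Module.supportDim R (R ⧸ I) :=
    (length_le_supportDim_quotient_of_mem_associatedPrimes rs R reg hrs p hpR).trans
      (Module.supportDim_le_of_surjective (Submodule.factor hIp) (Submodule.factor_surjective hIp))
  have : Nontrivial (R ⧸ I) :=
    Ideal.Quotient.nontrivial_iff.mpr fun h ↦ hpp.ne_top (top_le_iff.mp (h ▸ hIp))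
  obtain ⟨ss, hreg, hss, hslen⟩ := hH.exists_isRegular
  -- For I = 0 the annihilator is R and the quotient is zero.
  by_cases hI0 : I = ⊥
  · have := hI0
    subst this
    have hs : Subsingleton (R ⧸ Module.annihilator R (⊥ : Ideal R)) :=
      Ideal.Quotient.subsingleton_iff.mpr (Module.annihilator_eq_top_iff.mpr inferInstance)
    exact ⟨⟨inferInstance, fun h ↦ (not_subsingleton _ hs).elim⟩,
      fun h ↦ (not_subsingleton _ hs).elim⟩
  · exact hG.isMaximalCohenMacaulayModule_quotient_annihilator reg hrs hlen I hI0 hreg hss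
      (by rw [← hslen] at hdim; exact_mod_cast hdim)
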